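/- Let $I$ be an arbitrary set (finite, infinite, possibly uncountable), and let $(X_i,P_i)_{i\in I}$ be a qualitative game: each $X_i$ is a topological space (the strategy set of player $i$), $X=\prod_{i\in I}X_i$ carries the product topology, and $P_i:X\to 2^{X_i}$ is a set-valued map (the preference correspondence of player $i$), possibly with empty values. For $y\in X_i$ write $P_i^{-1}(y)=\{x\in X: y\in P_i(x)\}$, and let $\Delta_n=\{\lambda\in\mathbb{R}^{n+1}:\lambda_j\ge 0 \text{ for all } j,\ \sum_{j=0}^n\lambda_j=1\}$. Suppose that for each $i\in I$: (c1) $X_i$ is a nonempty compact Hausdorff space; (c2) for each finite subset $\{x_{i0},x_{i1},\dots,x_{in}\}$ of $X_i$ (with $x_{i0},\dots,x_{in}$ distinct) there is a continuous map $\varphi:\Delta_n\to X_i$ such that for every $J\subseteq\{0,1,\dots,n\}$ and every $x\in\bigcap_{j\in J}P_i^{-1}(x_{ij})$ one has $\varphi(\lambda)\in P_i(x)$ for all $\lambda\in\Delta_n$ with $\lambda_j=0$ for all $j\notin J$; (c3) $P_i$ has open lower sections, i.e. $P_i^{-1}(y)$ is open in $X$ for every $y\in X_i$; (c4) $x_i\notin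 P_i(x)$ for all $x\in X$, where $x_i$ is the $i$-th coordinate of $x$. Then the game has an equilibrium: there is $x^*\in X$ with $P_i(x^*)=\emptyset$ for every $i\in I$. -/

import Mathlib

namespace QualitativeGame

/-- The lower section `T⁻¹(z) = {y | z ∈ T y}` of a correspondence `T : Y → 2^Z`. -/
def lowerSection {Y Z : Type*} (T : Y → Set Z) (z : Z) : Set Y :=
  {y | z ∈ T y}

/-- For each finite subset `{z₀, …, zₙ}` of `Z` (listed without repetition) there is a continuous
map `φ : Δₙ → Z` such that, for every `J ⊆ {0, …, n}`, if `y ∈ ⋂_{j ∈ J} T⁻¹(zⱼ)` then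
`φ Λ ∈ T y` for every `Λ ∈ Δₙ` all of whose coordinates outside `J` vanish. -/
def SimplexMapCondition {Y Z : Type*} [TopologicalSpace Z] (T : Y → Set Z) : Prop :=
  ∀ (n : ℕ) (z : Fin (n + 1) → Z), Function.Injective z →
    ∃ φ : stdSimplex ℝ (Fin (n + 1)) → Z, Continuous φ ∧
      ∀ (J : Set (Fin (n + 1))) (y : Y), y ∈ ⋂ j ∈ J, lowerSection T (z j) →
        ∀ Λ : stdSimplex ℝ (Fin (n + 1)),
          (∀ j, j ∉ J → (Λ : Fin (n + 1) → ℝ) j = 0) → φ Λ ∈ T y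

/-- An equilibrium of the qualitative game with strategy sets `X i` and preference
correspondences `P i : ∏ j, X j → 2^(X i)`: a point where every `P i` is empty. -/
def IsEquilibrium {I : Type*} {X : I → Type*} (P : (i : I) → ((j : I) → X j) → Set (X i))
    (x : (j : I) → X j) : Prop :=
  ∀ i : I, P i x = ∅

end QualitativeGame

/-! Without an equilibrium, the sets `{x | y ∈ P i x}` form an open cover of the compact product,
and finitely many pairs `(i, y)` already suffice. For each player occurring in them, the simplex
condition gives a continuous map `φ` from a simplex; all other players are frozen at a base point.
Together these form a continuous `Φ` from a finite product of simplices to the strategy space, so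
infinitely many players cost nothing.

The pulled-back cover yields, via Brouwer and a Nash-type map (`exists_carried_of_isOpen_cover`), a
point `l` and a player `k` such that `l k` is supported on indices `j` with `z k j ∈ P k (Φ l)`. The
simplex condition then puts `Φ l k = φ k (l k)` in `P k (Φ l)`, contradicting irreflexivity.

Brouwer itself comes from Scarf's lemma, a parity argument applied to the grid points of a simplex.
-/

/-! ### Parity of rainbow sets -/

-- The count is 0, 1 or 2. In a rainbow `S` only the vertex coloured `i₀` can go. Otherwise, if some
-- facet qualifies, `S` misses `i₀` and repeats exactly one colour; the removable vertices are the
-- two sharing it.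
open Finset in
theorem odd_card_rainbow_facets_iff {V I : Type*} [DecidableEq V] [Fintype I] [DecidableEq I]
    (S : Finset V) (hS : #S = Fintype.card I) (c : V → I) (i₀ : I) :
    Odd #{v ∈ S | (S.erase v).image c = univ.erase i₀} ↔ S.image c = univ := by
  constructor
  · intro hodd
    by_contra hne
    obtain ⟨v₀, hv₀⟩ := card_pos.mp hodd.pos
    obtain ⟨hv₀S, hv₀c⟩ := mem_filter.mp hv₀
    have hmem : ∀ k, k ≠ i₀ ↔ ∃ w, w ≠ v₀ ∧ w ∈ S ∧ c w = k := by
      intro k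
      have := Finset.ext_iff.mp hv₀c k
      simp only [mem_image, mem_erase, mem_univ, and_true] at this
      rw [← this]
      simp [and_assoc]
    have hcv₀ : c v₀ ≠ i₀ := by
      intro h
      apply hne
      ext k
      simp only [mem_image, mem_univ, iff_true]
      by_cases hk : k = i₀
      · exact ⟨v₀, hv₀S, by rw [h, hk]⟩
      · obtain ⟨w, -, hw, hwk⟩ := (hmem k).mp hk
        exact ⟨w, hw, hwk⟩
    have hinj : Set.InjOn c (S.erase v₀) := by
      rw [← card_image_iff, hv₀c, card_erase_of_mem (mem_univ _), card_erase_of_mem hv₀S, hS,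
        card_univ]
    obtain ⟨v₁, hv₁v₀, hv₁S, hv₁⟩ := (hmem _).mp hcv₀
    have : {v ∈ S | (S.erase v).image c = univ.erase i₀} = {v₀, v₁} := by
      ext v
      simp only [mem_filter, mem_insert, mem_singleton]
      constructor
      · rintro ⟨hvS, hv⟩
        by_contra! hcon
        have hcv : c v ∈ univ.erase i₀ := by
          rw [← hv₀c]
          exact mem_image_of_mem _ (mem_erase.mpr ⟨hcon.1, hvS⟩)
        rw [← hv] at hcv
        obtain ⟨w, hw, hwv⟩ := mem_image.mp hcv
        obtain ⟨hwne, hwS⟩ := mem_erase.mp hw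
        by_cases hw0 : w = v₀
        · subst hw0
          exact hcon.2 (hinj (by simp [hvS, hcon.1]) (by simp [hv₁S, hv₁v₀]) (by rw [hv₁, hwv]))
        · exact hwne (hinj (by simp [hwS, hw0]) (by simp [hvS, hcon.1]) hwv)
      · rintro (rfl | rfl)
        · exact ⟨hv₀S, hv₀c⟩
        · refine ⟨hv₁S, ?_⟩
          ext k
          simp only [mem_image, mem_erase, mem_univ, and_true]
          rw [hmem k]
          constructor
          · rintro ⟨w, ⟨hw, hwS⟩, rfl⟩
            by_cases hw0 : w = v₀
            · exact ⟨v, hv₁v₀, hv₁S, by rw [hv₁, hw0]⟩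
            · exact ⟨w, hw0, hwS, rfl⟩
          · rintro ⟨w, hw, hwS, rfl⟩
            by_cases hw1 : w = v
            · exact ⟨v₀, ⟨hv₁v₀.symm, hv₀S⟩, by rw [hw1, hv₁]⟩
            · exact ⟨w, ⟨hw1, hwS⟩, rfl⟩
    rw [this, card_pair hv₁v₀.symm] at hodd
    exact absurd hodd (by decide)
  · intro h
    have hinj : Set.InjOn c S := by rw [← card_image_iff, h, hS, card_univ]
    obtain ⟨v, hv, hvc⟩ := mem_image.mp (h ▸ mem_univ i₀ : i₀ ∈ S.image c)
    have : {v ∈ S | (S.erase v).image c = univ.erase i₀} = {v} := by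
      ext w
      simp only [mem_filter, mem_singleton]
      constructor
      · rintro ⟨hw, hwc⟩
        by_contra hne
        have : i₀ ∈ (S.erase w).image c :=
          mem_image.mpr ⟨v, mem_erase.mpr ⟨Ne.symm hne, hv⟩, hvc⟩
        rw [hwc] at this
        simp at this
      · rintro rfl
        refine ⟨hv, ?_⟩
        ext k
        simp only [mem_image, mem_erase, mem_univ, and_true]
        constructor
        · rintro ⟨u, ⟨hu, huS⟩, rfl⟩ h'
          exact hu (hinj huS hv (h'.trans hvc.symm))
        · intro hk
          obtain ⟨u, hu, rfl⟩ := mem_image.mp (h ▸ mem_univ k : k ∈ S.image c)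
          exact ⟨u, ⟨fun h' => hk (h' ▸ hvc), hu⟩, rfl⟩
    rw [this]
    simp

open Finset in
/-- If every set of `|I| - 1` vertices lies in an even number of members of a family of sets of
`|I|` vertices, then the number of rainbow members of the family is even. -/
theorem even_card_rainbow {V I : Type*} [Fintype V] [DecidableEq V] [Fintype I] [DecidableEq I]
    [Nonempty I] (R : Finset (Finset V)) (hcard : ∀ S ∈ R, #S = Fintype.card I)
    (hR : ∀ D : Finset V, #D + 1 = Fintype.card I → Even #{v | v ∉ D ∧ insert v D ∈ R})
    (c : V → I) : Even #{S ∈ R | S.image c = univ} := by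
  obtain ⟨i₀⟩ := ‹Nonempty I›
  -- Double count flags (set, removed vertex), grouped by the set in `A` and by the facet in `B`.
  let A : Finset (Σ _ : Finset V, V) :=
    R.sigma fun S => {v ∈ S | (S.erase v).image c = univ.erase i₀}
  let B : Finset (Σ _ : Finset V, V) :=
    ({D | #D + 1 = Fintype.card I ∧ D.image c = univ.erase i₀} : Finset (Finset V)).sigma
      fun D => {v | v ∉ D ∧ insert v D ∈ R}
  have hAB : #A = #B := by
    refine card_nbij' (fun p => ⟨p.1.erase p.2, p.2⟩) (fun p => ⟨insert p.2 p.1, p.2⟩) ?_ ?_ ?_ ?_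
    · rintro ⟨S, v⟩ h
      simp only [A, B, coe_sigma, Set.mem_sigma_iff, mem_coe, mem_filter, mem_univ, true_and]
        at h ⊢
      refine ⟨⟨?_, h.2.2⟩, by simp, by rw [insert_erase h.2.1]; exact h.1⟩
      rw [card_erase_add_one h.2.1, hcard S h.1]
    · rintro ⟨D, v⟩ h
      simp only [A, B, coe_sigma, Set.mem_sigma_iff, mem_coe, mem_filter, mem_univ, true_and]
        at h ⊢
      refine ⟨h.2.2, by simp, by rw [erase_insert h.2.1]; exact h.1.2⟩
    · rintro ⟨S, v⟩ h
      simp only [A, coe_sigma, Set.mem_sigma_iff, mem_coe, mem_filter] at h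
      simp [insert_erase h.2.1]
    · rintro ⟨D, v⟩ h
      simp only [B, coe_sigma, Set.mem_sigma_iff, mem_coe, mem_filter, mem_univ, true_and]
        at h
      simp [erase_insert h.2.1]
  have hB : Even #B := by
    rw [card_sigma]
    exact even_sum _ fun D hD => hR D (mem_filter.mp hD).2.1
  rw [← hAB, card_sigma, ← Nat.not_odd_iff_even, odd_sum_iff_odd_card_odd,
    Nat.not_odd_iff_even] at hB
  convert hB using 2
  ext S
  simp only [mem_filter]
  exact and_congr_right fun hS => (odd_card_rainbow_facets_iff S (hcard S hS) c i₀).symm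

/-! ### Dominant sets and Scarf's lemma -/

/-- `S ⊆ I ⊕ T` is dominant if no `t : T` beats all of `S ∩ T` in every order indexed by an
`i : I` outside `S`. -/
def IsDominant {I T α : Type*} [LE α] (r : I → T → α) (S : Finset (I ⊕ T)) : Prop :=
  ∀ t, ∃ i, Sum.inl i ∉ S ∧ ∀ s, Sum.inr s ∈ S → r i t ≤ r i s

theorem IsDominant.mono {I T α : Type*} [LE α] {r : I → T → α} {S S' : Finset (I ⊕ T)}
    (h : IsDominant r S') (hS : S ⊆ S') : IsDominant r S := fun t => by
  obtain ⟨i, hi, hs⟩ := h t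
  exact ⟨i, fun h => hi (hS h), fun s h => hs s (hS h)⟩

-- This is Scarf's pivot step. Let `f i` be the `r i`-least point of `D`. Dominance makes `f` map
-- `E`, the indices outside `D`, onto the points of `D`, which number one fewer; so exactly one pair
-- `a`, `b` shares a value. Each extension of `D` gives up one of these two indices.
open Finset in
theorem exists_pair_isDominant_insert_iff {I T α : Type*} [Fintype I] [DecidableEq I] [Fintype T]
    [DecidableEq T] [LinearOrder α] (r : I → T → α) (hr : ∀ i, Function.Injective (r i))
    (D : Finset (I ⊕ T)) (hD : #D + 1 = Fintype.card I) (hdom : IsDominant r D)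
    (hne : ∃ t, Sum.inr t ∈ D) :
    ∃ v₀ v₁, v₀ ≠ v₁ ∧ ∀ v, (v ∉ D ∧ IsDominant r (insert v D)) ↔ v = v₀ ∨ v = v₁ := by
  classical
  have hex : ∀ i, ∃ s ∈ D.toRight, ∀ t ∈ D.toRight, r i s ≤ r i t := fun i =>
    exists_min_image _ _ (by obtain ⟨t, ht⟩ := hne; exact ⟨t, by simpa using ht⟩)
  choose f hfD hfmin using hex
  simp only [mem_toRight] at hfD hfmin
  have hfeq : ∀ i s, Sum.inr s ∈ D → (∀ t, Sum.inr t ∈ D → r i s ≤ r i t) → f i = s :=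
    fun i s hs h => hr i (le_antisymm (hfmin i s hs) (h _ (hfD i)))
  set E : Finset I := D.toLeftᶜ with hE
  have hEmem : ∀ i, i ∈ E ↔ Sum.inl i ∉ D := fun i => by simp [hE]
  have hEcard : #E = #D.toRight + 1 := by
    have := card_toLeft_add_card_toRight (u := D)
    rw [hE, card_compl]
    omega
  have hsurj : ∀ s, Sum.inr s ∈ D → ∃ i ∈ E, f i = s := fun s hs => by
    obtain ⟨i, hi, h⟩ := hdom s
    exact ⟨i, (hEmem i).mpr hi, hfeq i s hs h⟩
  obtain ⟨a, ha, b, hb, hab, hfab⟩ := exists_ne_map_eq_of_card_lt_of_maps_to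
    (by omega : #D.toRight < #E) (f := f) (fun i _ => by simpa using hfD i)
  have hinj : ∀ j ∈ E, (∀ s, Sum.inr s ∈ D → ∃ i ∈ E, i ≠ j ∧ f i = s) →
      Set.InjOn f (E.erase j) := by
    intro j hj h
    refine injOn_of_surjOn_of_card_le (t := D.toRight) f (fun i _ => by simpa using hfD i) ?_ ?_
    · intro s hs
      obtain ⟨i, hi, hij, rfl⟩ := h s (by simpa using hs)
      exact ⟨i, by simp [hi, hij], rfl⟩
    · rw [card_erase_of_mem hj]
      omega
  have hsurja : ∀ s, Sum.inr s ∈ D → ∃ i ∈ E, i ≠ a ∧ f i = s := fun s hs => by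
    obtain ⟨i, hi, rfl⟩ := hsurj s hs
    by_cases hia : i = a
    · exact ⟨b, hb, hab.symm, by rw [hia, hfab]⟩
    · exact ⟨i, hi, hia, rfl⟩
  have hsurjb : ∀ s, Sum.inr s ∈ D → ∃ i ∈ E, i ≠ b ∧ f i = s := fun s hs => by
    obtain ⟨i, hi, rfl⟩ := hsurj s hs
    by_cases hib : i = b
    · exact ⟨a, ha, hab, by rw [hib, hfab]⟩
    · exact ⟨i, hi, hib, rfl⟩
  have hpair : ∀ j ∈ E, (∀ s, Sum.inr s ∈ D → ∃ i ∈ E, i ≠ j ∧ f i = s) → j = a ∨ j = b := by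
    intro j hj h
    by_contra! hcon
    exact hab (hinj j hj h (by simp [ha, hcon.1.symm]) (by simp [hb, hcon.2.symm]) hfab)
  have key : ∀ j ∈ E, (∀ s, Sum.inr s ∈ D → ∃ i ∈ E, i ≠ j ∧ f i = s) →
      ∃ v : I ⊕ T, v ∉ D ∧ IsDominant r (insert v D) ∧
        (∀ j', v = Sum.inl j' → j' = j) ∧
        (∀ t, v = Sum.inr t → ∀ i ∈ E, i ≠ j → r i (f i) < r i t) ∧
        (IsDominant r (insert (Sum.inl j) D) → v = Sum.inl j) ∧
        (∀ t, (∀ i ∈ E, i ≠ j → r i (f i) < r i t) →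
          (∀ u, (∀ i ∈ E, i ≠ j → r i (f i) < r i u) → r j u ≤ r j t) → v = Sum.inr t) := by
    intro j hj hjs
    -- `M` holds the points that would violate dominance if index `j` were given up. If there are
    -- none, `inl j` can be added; otherwise the `r j`-largest of them takes its place.
    let M : Finset T := {t | ∀ i ∈ E, i ≠ j → r i (f i) < r i t}
    have hM : ∀ t, t ∈ M ↔ ∀ i ∈ E, i ≠ j → r i (f i) < r i t := fun t => by simp [M]
    rcases M.eq_empty_or_nonempty with hMe | hMne
    · refine ⟨Sum.inl j, (hEmem j).mp hj, ?_, fun j' h => (Sum.inl.inj h).symm, ?_, fun _ => rfl,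
        ?_⟩
      · intro t
        have : t ∉ M := by simp [hMe]
        rw [hM] at this
        push Not at this
        obtain ⟨i, hi, hij, hit⟩ := this
        refine ⟨i, by simp [hij, (hEmem i).mp hi], fun s hs => hit.trans (hfmin i s ?_)⟩
        simpa using hs
      · intro t h
        cases h
      · intro t ht _
        have : t ∈ M := (hM t).mpr ht
        simp [hMe] at this
    · obtain ⟨t, htM, htmax⟩ := exists_max_image M (r j) hMne
      have htD : Sum.inr t ∉ D := by
        intro h
        obtain ⟨i, hi, hij, rfl⟩ := hjs t h
        exact lt_irrefl _ ((hM _).mp htM i hi hij)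
      refine ⟨Sum.inr t, htD, ?_, fun j' h => (by cases h), ?_, ?_, ?_⟩
      · intro u
        by_cases hu : u ∈ M
        · refine ⟨j, by simpa using (hEmem j).mp hj, fun s hs => ?_⟩
          rcases mem_insert.mp hs with h | h
          · cases h
            exact htmax u hu
          · obtain ⟨i, hi, hiu⟩ := hdom u
            by_cases hij : i = j
            · exact hij ▸ hiu s h
            · exact absurd ((hM u).mp hu i ((hEmem i).mpr hi) hij) (not_lt.mpr (hiu _ (hfD i)))
        · rw [hM] at hu
          push Not at hu
          obtain ⟨i, hi, hij, hiu⟩ := hu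
          refine ⟨i, by simpa using (hEmem i).mp hi, fun s hs => ?_⟩
          rcases mem_insert.mp hs with h | h
          · cases h
            exact hiu.trans ((hM _).mp htM i hi hij).le
          · exact hiu.trans (hfmin i s h)
      · intro t' h
        cases h
        exact (hM _).mp htM
      · intro h
        obtain ⟨i, hi, hit⟩ := h t
        simp only [mem_insert, Sum.inl.injEq, not_or, reduceCtorEq, false_or] at hi hit
        exact absurd ((hM _).mp htM i ((hEmem i).mpr hi.2) hi.1) (not_lt.mpr (hit _ (hfD i)))
      · intro t' ht' hmax
        congr 1
        exact hr j (le_antisymm (hmax t ((hM t).mp htM)) (htmax t' ((hM t').mpr ht')))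
  obtain ⟨v₀, hv₀D, hv₀, hl₀, hr₀, hul₀, hur₀⟩ := key a ha hsurja
  obtain ⟨v₁, hv₁D, hv₁, hl₁, hr₁, hul₁, hur₁⟩ := key b hb hsurjb
  refine ⟨v₀, v₁, ?_, fun v => ⟨?_, ?_⟩⟩
  · rintro rfl
    rcases v₀ with j | t
    · exact hab ((hl₀ j rfl).symm.trans (hl₁ j rfl))
    -- A common new point would beat `D` in every order of `E`, since no index equals both `a` and
    -- `b`.
    · obtain ⟨i, hi, hit⟩ := hdom t
      have h := not_lt.mpr (hit _ (hfD i))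
      by_cases hia : i = a
      · exact h (hr₁ t rfl i ((hEmem i).mpr hi) (hia ▸ hab))
      · exact h (hr₀ t rfl i ((hEmem i).mpr hi) hia)
  · rintro ⟨hvD, hv⟩
    rcases v with j | t
    · have hj : j ∈ E := (hEmem j).mpr hvD
      have : j = a ∨ j = b := by
        refine hpair j hj fun s hs => ?_
        obtain ⟨i, hi, h⟩ := hv s
        simp only [mem_insert, Sum.inl.injEq, not_or, reduceCtorEq, false_or] at hi h
        exact ⟨i, (hEmem i).mpr hi.2, hi.1, hfeq i s hs h⟩
      rcases this with rfl | rfl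
      · exact Or.inl (hul₀ hv).symm
      · exact Or.inr (hul₁ hv).symm
    · obtain ⟨j, hj, hjt⟩ := hv t
      simp only [mem_insert, Sum.inr.injEq, reduceCtorEq, false_or] at hj hjt
      have hjE : j ∈ E := (hEmem j).mpr hj
      have hk : ∀ s, Sum.inr s ∈ D → ∃ i ∈ E, i ≠ j ∧ f i = s ∧ r i s ≤ r i t := by
        intro s hs
        obtain ⟨i, hi, his⟩ := hv s
        simp only [mem_insert, Sum.inr.injEq, reduceCtorEq, false_or] at hi his
        refine ⟨i, (hEmem i).mpr hi, ?_, hfeq i s hs fun u hu => his u (Or.inr hu),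
          his t (Or.inl rfl)⟩
        rintro rfl
        have : s = t := hr i (le_antisymm (his t (Or.inl rfl)) (hjt s (Or.inr hs)))
        exact hvD (this ▸ hs)
      have hk' : ∀ s, Sum.inr s ∈ D → ∃ i ∈ E, i ≠ j ∧ f i = s := fun s hs => by
        obtain ⟨i, hi, hij, h, -⟩ := hk s hs
        exact ⟨i, hi, hij, h⟩
      have hlt : ∀ i ∈ E, i ≠ j → r i (f i) < r i t := by
        intro i hi hij
        obtain ⟨k, hkE, hkj, hfk, hkt⟩ := hk (f i) (hfD i)
        have : k = i := hinj j hjE hk' (by simp [hkE, hkj]) (by simp [hi, hij]) hfk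
        subst this
        refine lt_of_le_of_ne hkt fun h => hvD ?_
        rw [← hr k h]
        exact hfD k
      have hmax : ∀ u, (∀ i ∈ E, i ≠ j → r i (f i) < r i u) → r j u ≤ r j t := by
        intro u hu
        obtain ⟨i, hi, hiu⟩ := hv u
        simp only [mem_insert, Sum.inr.injEq, reduceCtorEq, false_or] at hi hiu
        by_cases hij : i = j
        · exact hij ▸ hiu t (Or.inl rfl)
        · exact absurd (hu i ((hEmem i).mpr hi) hij) (not_lt.mpr (hiu _ (Or.inr (hfD i))))
      rcases hpair j hjE hk' with rfl | rfl
      · exact Or.inl (hur₀ t hlt hmax).symm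
      · exact Or.inr (hur₁ t hlt hmax).symm
  · rintro (rfl | rfl)
    · exact ⟨hv₀D, hv₀⟩
    · exact ⟨hv₁D, hv₁⟩

open Finset in
/-- Scarf's lemma. -/
theorem exists_rainbow_isDominant {I T α : Type*} [Fintype I] [DecidableEq I] [Nonempty I]
    [Fintype T] [DecidableEq T] [Nonempty T] [LinearOrder α] (r : I → T → α)
    (hr : ∀ i, Function.Injective (r i)) (c : T → I) :
    ∃ S : Finset (I ⊕ T), IsDominant r S ∧ ∀ i, Sum.inl i ∉ S → ∃ s, Sum.inr s ∈ S ∧ c s = i := by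
  classical
  set L : Finset (I ⊕ T) := univ.map Function.Embedding.inl with hL
  have hLl : ∀ i, Sum.inl i ∈ L := fun i => by simp [hL]
  have hLr : ∀ t, Sum.inr t ∉ L := fun t => by simp [hL]
  have hLcard : #L = Fintype.card I := by simp [hL]
  have hLdom : ∀ S, L ⊆ S → ¬ IsDominant r S := fun S hS h => by
    obtain ⟨i, hi, -⟩ := h (Classical.arbitrary T)
    exact hi (hS (hLl i))
  -- `L` is not dominant; adjoining it repairs the parity at the facets contained in `L`. It is
  -- rainbow, so evenness forces a second rainbow member.
  let R : Finset (Finset (I ⊕ T)) := {S | #S = Fintype.card I ∧ (IsDominant r S ∨ S = L)}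
  have heven := even_card_rainbow R (fun S hS => (mem_filter.mp hS).2.1) (fun D hD => by
    have hRD : ∀ v, (v ∉ D ∧ insert v D ∈ R) ↔
        (v ∉ D ∧ (IsDominant r (insert v D) ∨ insert v D = L)) := fun v =>
      and_congr_right fun hv => by simp [R, card_insert_of_notMem hv, hD]
    simp_rw [hRD]
    have of_pair : ∀ v₀ v₁ : I ⊕ T, v₀ ≠ v₁ →
        (∀ v, (v ∉ D ∧ (IsDominant r (insert v D) ∨ insert v D = L)) ↔ v = v₀ ∨ v = v₁) →
        Even #{v | v ∉ D ∧ (IsDominant r (insert v D) ∨ insert v D = L)} := by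
      intro v₀ v₁ hne h
      have : ({v | v ∉ D ∧ (IsDominant r (insert v D) ∨ insert v D = L)} : Finset (I ⊕ T)) =
          {v₀, v₁} := by
        ext v
        simp [h v]
      rw [this, card_pair hne]
      exact even_two
    by_cases hne : ∃ t, Sum.inr t ∈ D
    · have hnL : ∀ v, insert v D ≠ L := fun v h => by
        obtain ⟨t, ht⟩ := hne
        exact hLr t (h ▸ mem_insert_of_mem ht)
      by_cases hdom : IsDominant r D
      · obtain ⟨v₀, v₁, h01, h⟩ := exists_pair_isDominant_insert_iff r hr D hD hdom hne
        exact of_pair v₀ v₁ h01 fun v => by simpa [hnL v] using h v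
      · have : ({v | v ∉ D ∧ (IsDominant r (insert v D) ∨ insert v D = L)} : Finset (I ⊕ T)) =
            ∅ := by
          ext v
          simp only [mem_filter, mem_univ, true_and, notMem_empty, iff_false, hnL v, or_false]
          exact fun h => hdom (h.2.mono (subset_insert _ _))
        rw [this]
        exact Even.zero
    · push Not at hne
      have hDL : D ⊆ L := fun v hv => by
        rcases v with i | t
        · exact hLl i
        · exact absurd hv (hne t)
      obtain ⟨v, hv⟩ := card_eq_one.mp (by
        rw [card_sdiff_of_subset hDL]
        omega : #(L \ D) = 1)
      have hvm : v ∈ L \ D := hv ▸ mem_singleton_self v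
      rw [mem_sdiff] at hvm
      rcases v with i | t
      swap
      · exact absurd hvm.1 (hLr t)
      have hDi : ∀ k, Sum.inl k ∉ D ↔ k = i := fun k => by
        have := Finset.ext_iff.mp hv (Sum.inl k)
        simpa [hLl k] using this
      -- Here `D` is `L` without `inl i`: one extension is `L`, the other adds the `r i`-largest
      -- point.
      obtain ⟨t, -, ht⟩ := exists_max_image (univ : Finset T) (r i) univ_nonempty
      refine of_pair (Sum.inl i) (Sum.inr t) (by simp) fun v => ⟨?_, ?_⟩
      · rintro ⟨hvD, hvR⟩
        rcases v with k | u
        · exact Or.inl (congrArg _ ((hDi k).mp hvD))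
        · refine Or.inr (congrArg _ ?_)
          rcases hvR with h | h
          · obtain ⟨k, hk, hku⟩ := h t
            simp only [mem_insert, reduceCtorEq, false_or] at hk
            obtain rfl := (hDi k).mp hk
            exact hr k (le_antisymm (ht u (mem_univ u)) (hku u (mem_insert_self _ _)))
          · exact absurd (h ▸ mem_insert_self _ _) (hLr u)
      · rintro (rfl | rfl)
        · refine ⟨hvm.2, Or.inr ?_⟩
          rw [insert_eq, ← hv, sdiff_union_of_subset hDL]
        · refine ⟨hne t, Or.inl fun u => ⟨i, by simpa using hvm.2, fun s hs => ?_⟩⟩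
          have : s = t := by simpa [hne s] using hs
          rw [this]
          exact ht u (mem_univ u)) (Sum.elim id c)
  have hLmem : L ∈ ({S ∈ R | S.image (Sum.elim id c) = univ} : Finset (Finset (I ⊕ T))) := by
    simp only [mem_filter, R, mem_univ, true_and, hLcard, or_true]
    ext i
    simp only [mem_image, mem_univ, iff_true]
    exact ⟨Sum.inl i, hLl i, rfl⟩
  have h2 : 1 < #{S ∈ R | S.image (Sum.elim id c) = univ} := by
    have := card_pos.mpr ⟨L, hLmem⟩
    obtain ⟨k, hk⟩ := heven
    omega
  obtain ⟨S, hS, hSL⟩ := exists_mem_ne h2 L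
  simp only [mem_filter, R, mem_univ, true_and] at hS
  refine ⟨S, hS.1.2.resolve_right hSL, fun i hi => ?_⟩
  obtain ⟨v, hv, hvi⟩ := mem_image.mp (hS.2 ▸ mem_univ i : i ∈ S.image (Sum.elim id c))
  rcases v with k | t
  · exact absurd hv (by simpa using (show k = i from hvi) ▸ hi)
  · exact ⟨t, hv, hvi⟩

/-! ### Brouwer's theorem on a simplex -/

-- Scarf's lemma for the coordinate orders. Dominance prevents a grid point from exceeding all the
-- minima over `S` on `C`, so these minima sum to nearly `N`. This pins the points of `S` within
-- `Fintype.card ι` of each other.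
open Finset in
theorem exists_close_grid_points {ι : Type*} [Fintype ι] [DecidableEq ι] [Nonempty ι] (N : ℕ)
    (c : (ι → ℕ) → ι) :
    ∃ x ∈ piAntidiag (univ : Finset ι) N, ∃ C : Finset ι,
      (∀ k ∉ C, x k ≤ Fintype.card ι) ∧
      ∀ i ∈ C, ∃ s ∈ piAntidiag (univ : Finset ι) N, c s = i ∧
        ∀ k, s k ≤ x k + Fintype.card ι ∧ x k ≤ s k + Fintype.card ι := by
  classical
  let T := {x : ι → ℕ // x ∈ piAntidiag (univ : Finset ι) N}
  have hT : ∀ x : ι → ℕ, x ∈ piAntidiag (univ : Finset ι) N ↔ ∑ i, x i = N := fun x => by simp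
  have : Nonempty T := ⟨⟨Pi.single (Classical.arbitrary ι) N, (hT _).mpr (by simp)⟩⟩
  let e := Fintype.equivFin T
  -- The numbering `e` breaks ties, making each order injective.
  let r : ι → T → ℕ ×ₗ Fin (Fintype.card T) := fun i x => toLex (x.1 i, e x)
  have hr : ∀ i, Function.Injective (r i) := fun i x y h =>
    e.injective (congrArg (·.2) (toLex.injective h))
  obtain ⟨S, hdom, hS⟩ := exists_rainbow_isDominant r hr fun x => c x.1
  set C : Finset ι := {i | Sum.inl i ∉ S} with hC
  have hCmem : ∀ i, i ∈ C ↔ Sum.inl i ∉ S := fun i => by simp [hC]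
  have hle : ∀ t : T, ∃ i ∈ C, ∀ s : T, Sum.inr s ∈ S → t.1 i ≤ s.1 i := fun t => by
    obtain ⟨i, hi, h⟩ := hdom t
    refine ⟨i, (hCmem i).mpr hi, fun s hs => ?_⟩
    rcases Prod.Lex.toLex_le_toLex.mp (h s hs) with h' | h'
    · exact h'.le
    · exact h'.1.le
  obtain ⟨i₁, hi₁, -⟩ := hle (Classical.arbitrary T)
  obtain ⟨x, hxS, -⟩ := hS i₁ ((hCmem _).mp hi₁)
  have hmin : ∀ i, ∃ s ∈ S.toRight, ∀ t ∈ S.toRight, s.1 i ≤ t.1 i := fun i =>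
    exists_min_image _ _ ⟨x, by simpa using hxS⟩
  choose p hpS hp using hmin
  simp only [mem_toRight] at hpS hp
  have hsum : N ≤ ∑ i ∈ C, (p i).1 i + Fintype.card ι := by
    by_contra! hcon
    have hlt : ∑ i ∈ C, ((p i).1 i + 1) ≤ N := by
      rw [sum_add_distrib, sum_const, smul_eq_mul, mul_one]
      have := card_le_univ C
      omega
    -- One more than the minimum on `C`, with the surplus dumped on `i₁ ∈ C` to reach total `N`.
    let t : ι → ℕ := fun i => (if i ∈ C then (p i).1 i + 1 else 0) +
      (if i = i₁ then N - ∑ i ∈ C, ((p i).1 i + 1) else 0)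
    have ht : ∑ i, t i = N := by
      simp only [t, sum_add_distrib, sum_ite_mem, univ_inter, sum_ite_eq', mem_univ, if_true]
      rw [sum_add_distrib] at hlt
      omega
    obtain ⟨i, hi, h⟩ := hle ⟨t, (hT t).mpr ht⟩
    have := h _ (hpS i)
    simp only [t, hi, if_true] at this
    omega
  have hin : ∀ s : T, Sum.inr s ∈ S → ∀ k ∈ C, s.1 k ≤ (p k).1 k + Fintype.card ι := by
    intro s hs k hk
    have h1 : ∑ i ∈ C, s.1 i ≤ N :=
      (sum_le_sum_of_subset (subset_univ _)).trans_eq ((hT s.1).mp s.2)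
    have h2 : ∑ i ∈ C.erase k, (p i).1 i ≤ ∑ i ∈ C.erase k, s.1 i :=
      sum_le_sum fun i _ => hp i s hs
    rw [← add_sum_erase C _ hk] at h1 hsum
    omega
  have hout : ∀ s : T, Sum.inr s ∈ S → ∀ k ∉ C, s.1 k ≤ Fintype.card ι := by
    intro s hs k hk
    have h1 : ∑ i ∈ insert k C, s.1 i ≤ N :=
      (sum_le_sum_of_subset (subset_univ _)).trans_eq ((hT s.1).mp s.2)
    have h2 : ∑ i ∈ C, (p i).1 i ≤ ∑ i ∈ C, s.1 i := sum_le_sum fun i _ => hp i s hs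
    rw [sum_insert hk] at h1
    omega
  refine ⟨x.1, x.2, C, hout x hxS, fun i hi => ?_⟩
  obtain ⟨s, hs, hsi⟩ := hS i ((hCmem i).mp hi)
  refine ⟨s.1, s.2, hsi, fun k => ?_⟩
  by_cases hk : k ∈ C
  · have := hin s hs k hk
    have := hin x hxS k hk
    have := hp k s hs
    have := hp k x hxS
    omega
  · have := hout s hs k hk
    have := hout x hxS k hk
    omega

theorem exists_le_add_of_mapsTo_stdSimplex {ι : Type*} [Fintype ι] [Nonempty ι]
    {f : (ι → ℝ) → ι → ℝ} (hf : ContinuousOn f (stdSimplex ℝ ι))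
    (hmaps : Set.MapsTo f (stdSimplex ℝ ι) (stdSimplex ℝ ι)) {ε : ℝ} (hε : 0 < ε) :
    ∃ x ∈ stdSimplex ℝ ι, ∀ i, x i ≤ f x i + ε := by
  classical
  obtain ⟨δ, hδ, hfδ⟩ := Metric.uniformContinuousOn_iff.mp
    ((isCompact_stdSimplex ℝ ι).uniformContinuousOn_of_continuous hf) (ε / 2) (half_pos hε)
  obtain ⟨N, hN⟩ := exists_nat_gt ((Fintype.card ι : ℝ) / min δ (ε / 2))
  have hmin : 0 < min δ (ε / 2) := lt_min hδ (half_pos hε)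
  have hN0 : (0 : ℝ) < N := lt_of_le_of_lt (by positivity) hN
  have hNδ : (Fintype.card ι : ℝ) / N < min δ (ε / 2) := by
    rw [div_lt_iff₀ hmin] at hN
    rw [div_lt_iff₀ hN0]
    linarith
  let g : (ι → ℕ) → ι → ℝ := fun x i => (x i : ℝ) / N
  have hg : ∀ x ∈ Finset.piAntidiag (Finset.univ : Finset ι) N, g x ∈ stdSimplex ℝ ι := by
    intro x hx
    refine ⟨fun i => by positivity, ?_⟩
    have : ∑ i, x i = N := by simpa using hx
    simp only [g]
    rw [← Finset.sum_div, ← Nat.cast_sum, this, div_self hN0.ne']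
  -- Colour a grid point by a coordinate that `f` does not decrease; one exists because both
  -- coordinate sums are 1.
  have hcol : ∀ x : ι → ℕ, ∃ i, x ∈ Finset.piAntidiag (Finset.univ : Finset ι) N →
      g x i ≤ f (g x) i := by
    intro x
    by_contra! hcon
    obtain ⟨i₀⟩ := ‹Nonempty ι›
    have hx := (hcon i₀).1
    have := Finset.sum_lt_sum_of_nonempty ⟨i₀, Finset.mem_univ i₀⟩ fun i _ => (hcon i).2
    rw [(hg x hx).2, (hmaps (hg x hx)).2] at this
    exact lt_irrefl _ this
  choose c hc using hcol
  obtain ⟨x, hx, C, hxC, hC⟩ := exists_close_grid_points N c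
  refine ⟨g x, hg x hx, fun i => ?_⟩
  by_cases hi : i ∈ C
  · obtain ⟨s, hs, hsi, hclose⟩ := hC i hi
    have hcl : ∀ k, |g x k - g s k| < min δ (ε / 2) := by
      intro k
      refine lt_of_le_of_lt ?_ hNδ
      simp only [g]
      rw [← sub_div, abs_div, abs_of_pos hN0]
      gcongr
      have h1 : (s k : ℝ) ≤ x k + Fintype.card ι := by exact_mod_cast (hclose k).1
      have h2 : (x k : ℝ) ≤ s k + Fintype.card ι := by exact_mod_cast (hclose k).2
      rw [abs_le]
      constructor <;> linarith
    have hdist : dist (g x) (g s) < δ := (dist_pi_lt_iff hδ).mpr fun k => by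
      rw [Real.dist_eq]
      exact (hcl k).trans_le (min_le_left _ _)
    have hfd := (dist_pi_lt_iff (half_pos hε)).mp (hfδ _ (hg x hx) _ (hg s hs) hdist) i
    rw [Real.dist_eq] at hfd
    have h3 := hc s hs
    rw [hsi] at h3
    have h4 := (hcl i).trans_le (min_le_right _ _)
    rw [abs_lt] at hfd h4
    linarith [hfd.1, h4.2]
  · have h1 := (hmaps (hg x hx)).1 i
    have h2 : g x i ≤ (Fintype.card ι : ℝ) / N := by
      simp only [g]
      gcongr
      exact_mod_cast hxC i hi
    linarith [hNδ.trans_le (min_le_right _ _)]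

/-- Brouwer's fixed point theorem for the standard simplex. -/
theorem exists_fixedPoint_stdSimplex {ι : Type*} [Fintype ι] [Nonempty ι]
    {f : (ι → ℝ) → ι → ℝ} (hf : ContinuousOn f (stdSimplex ℝ ι))
    (hmaps : Set.MapsTo f (stdSimplex ℝ ι) (stdSimplex ℝ ι)) :
    ∃ x ∈ stdSimplex ℝ ι, f x = x := by
  classical
  have hne : (stdSimplex ℝ ι).Nonempty :=
    ⟨_, single_mem_stdSimplex ℝ (Classical.arbitrary ι)⟩
  have hcont : ContinuousOn (fun x => ∑ i, max (x i - f x i) 0) (stdSimplex ℝ ι) := by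
    have : ∀ i, ContinuousOn (fun x => f x i) (stdSimplex ℝ ι) := continuousOn_pi.mp hf
    fun_prop
  obtain ⟨x, hx, hmin⟩ := (isCompact_stdSimplex ℝ ι).exists_isMinOn hne hcont
  have hpos : (0 : ℝ) < Fintype.card ι := by exact_mod_cast Fintype.card_pos
  -- The minimal total excess is at most every `ε`, so no coordinate decreases; equal sums then
  -- force equality.
  have hzero : ∑ i, max (x i - f x i) 0 ≤ 0 := by
    refine le_of_forall_pos_le_add fun ε hε => ?_
    obtain ⟨y, hy, h⟩ := exists_le_add_of_mapsTo_stdSimplex hf hmaps (div_pos hε hpos)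
    calc ∑ i, max (x i - f x i) 0 ≤ ∑ i, max (y i - f y i) 0 := hmin hy
      _ ≤ ∑ _i : ι, ε / Fintype.card ι :=
        Finset.sum_le_sum fun i _ => max_le (by linarith [h i]) (by positivity)
      _ = 0 + ε := by
        rw [Finset.sum_const, Finset.card_univ, nsmul_eq_mul, mul_div_cancel₀ _ hpos.ne', zero_add]
  have hle : ∀ i, x i ≤ f x i := fun i => by
    have h1 := Finset.single_le_sum (f := fun i => max (x i - f x i) 0)
      (fun i _ => le_max_right _ _) (Finset.mem_univ i)
    have h2 := le_max_left (x i - f x i) 0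
    linarith
  refine ⟨x, hx, funext fun i => ?_⟩
  have := (Finset.sum_eq_sum_iff_of_le fun i _ => hle i).mp (by rw [hx.2, (hmaps hx).2])
  exact (this i (Finset.mem_univ i)).symm

/-! ### Products of simplices and the covering lemma -/

theorem exists_retraction_stdSimplex (J : Type*) [Fintype J] [Nonempty J] :
    ∃ r : (J → ℝ) → stdSimplex ℝ J, Continuous r ∧ ∀ x : stdSimplex ℝ J, r x.1 = x := by
  have hcard : (Fintype.card J : ℝ) ≠ 0 := by exact_mod_cast Fintype.card_ne_zero
  let s : (J → ℝ) → ℝ := fun x => ∑ j, max (x j) 0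
  have hs : Continuous s := by fun_prop
  have hpos : ∀ x, 0 < max (s x) 1 := fun x => lt_max_of_lt_right one_pos
  -- Take positive parts; spread a deficit of mass evenly, or divide out an excess.
  let ρ : (J → ℝ) → J → ℝ := fun x j =>
    (max (x j) 0 + max (1 - s x) 0 / Fintype.card J) / max (s x) 1
  have hρ : ∀ x, ρ x ∈ stdSimplex ℝ J := by
    intro x
    refine ⟨fun j => div_nonneg (by positivity) (hpos x).le, ?_⟩
    simp only [ρ]
    rw [← Finset.sum_div, Finset.sum_add_distrib, Finset.sum_const, Finset.card_univ,
      nsmul_eq_mul, mul_div_cancel₀ _ hcard, div_eq_one_iff_eq (hpos x).ne']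
    change s x + _ = _
    rcases le_total (s x) 1 with h | h
    · rw [max_eq_left (by linarith), max_eq_right h]
      ring
    · rw [max_eq_right (by linarith), max_eq_left h, add_zero]
  refine ⟨fun x => ⟨ρ x, hρ x⟩, ?_, ?_⟩
  · refine Continuous.subtype_mk (continuous_pi fun j => ?_) _
    exact Continuous.div (by fun_prop) (by fun_prop) fun x => (hpos x).ne'
  · intro x
    have hx : s x.1 = 1 := by
      rw [← x.2.2]
      exact Finset.sum_congr rfl fun j _ => max_eq_left (x.2.1 j)
    refine Subtype.ext (funext fun j => ?_)
    simp only [ρ, hx, max_eq_left (x.2.1 j)]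
    simp

/-- Brouwer's fixed point theorem for finite products of standard simplices. -/
theorem exists_fixedPoint_pi_stdSimplex {K : Type*} [Fintype K] {J : K → Type*}
    [∀ k, Fintype (J k)] [∀ k, Nonempty (J k)]
    {T : (∀ k, stdSimplex ℝ (J k)) → ∀ k, stdSimplex ℝ (J k)} (hT : Continuous T) :
    ∃ l, T l = l := by
  rcases isEmpty_or_nonempty K with hK | hK
  · exact ⟨isEmptyElim, Subsingleton.elim _ _⟩
  have hcard : (Fintype.card K : ℝ) ≠ 0 := by exact_mod_cast Fintype.card_ne_zero
  have : Nonempty (Σ k, J k) := ⟨⟨Classical.arbitrary K, Classical.arbitrary _⟩⟩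
  choose r hr hrid using fun k => exists_retraction_stdSimplex (J k)
  let ρ : ((Σ k, J k) → ℝ) → ∀ k, stdSimplex ℝ (J k) := fun x k =>
    r k fun j => Fintype.card K * x ⟨k, j⟩
  have hρ : Continuous ρ := continuous_pi fun k => (hr k).comp (by fun_prop)
  -- The product sits in one simplex over the disjoint union, each block having mass `1 /
  -- Fintype.card K`.
  let f : ((Σ k, J k) → ℝ) → (Σ k, J k) → ℝ := fun x q => (T (ρ x) q.1).1 q.2 / Fintype.card K
  have hf : Continuous f := continuous_pi fun q =>
    ((continuous_apply q.2).comp (continuous_subtype_val.comp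
      ((continuous_apply q.1).comp (hT.comp hρ)))).div_const _
  obtain ⟨x, -, hx⟩ := exists_fixedPoint_stdSimplex hf.continuousOn (fun x _ => by
    refine ⟨fun q => div_nonneg ((T (ρ x) q.1).2.1 q.2) (Nat.cast_nonneg _), ?_⟩
    simp only [f]
    rw [← Finset.sum_div, Fintype.sum_sigma, div_eq_one_iff_eq hcard]
    simp only [(T (ρ x) _).2.2]
    simp)
  refine ⟨ρ x, funext fun k => ?_⟩
  have : (fun j => Fintype.card K * x ⟨k, j⟩) = (T (ρ x) k).1 := funext fun j => by
    have hq : (T (ρ x) k).1 j / Fintype.card K = x ⟨k, j⟩ := congrFun hx ⟨k, j⟩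
    rw [← hq, mul_div_cancel₀ _ hcard]
  change _ = r k _
  rw [this, hrid]

theorem IsOpen.exists_continuous_pos_iff {E : Type*} [PseudoMetricSpace E] {V : Set E}
    (hV : IsOpen V) : ∃ g : E → ℝ, Continuous g ∧ (∀ x, 0 ≤ g x) ∧ ∀ x, 0 < g x ↔ x ∈ V := by
  rcases Vᶜ.eq_empty_or_nonempty with h | h
  · refine ⟨fun _ => 1, continuous_const, fun _ => zero_le_one, fun x => ?_⟩
    simp [Set.compl_empty_iff.mp h]
  · refine ⟨fun x => Metric.infDist x Vᶜ, Metric.continuous_infDist_pt _,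
      fun _ => Metric.infDist_nonneg, fun x => ?_⟩
    rw [← hV.isClosed_compl.notMem_iff_infDist_pos h, Set.notMem_compl_iff]

/-- If open sets `V k j` cover a finite product of simplices, some point `l` has a component `l k`
carried by those `j` for which `l ∈ V k j`. -/
theorem exists_carried_of_isOpen_cover {K : Type*} [Fintype K] {J : K → Type*}
    [∀ k, Fintype (J k)] [∀ k, Nonempty (J k)] {V : ∀ k, J k → Set (∀ k, stdSimplex ℝ (J k))}
    (hV : ∀ k j, IsOpen (V k j)) (hcover : ∀ l, ∃ k j, l ∈ V k j) :
    ∃ l : ∀ k, stdSimplex ℝ (J k), ∃ k, ∀ j, l ∉ V k j → (l k).1 j = 0 := by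
  choose g hg hg0 hgpos using fun k j => (hV k j).exists_continuous_pos_iff
  have hsum0 : ∀ k l, 0 ≤ ∑ j, g k j l := fun k l => Finset.sum_nonneg fun j _ => hg0 k j l
  have hden : ∀ k l, 0 < 1 + ∑ j, g k j l := fun k l => by linarith [hsum0 k l]
  -- Nash's map: at a fixed point `l`, `(l k) j * ∑ j, g k j l = g k j l`, so where the sum is
  -- positive, `g k j l = 0` forces a zero coordinate.
  let T : (∀ k, stdSimplex ℝ (J k)) → ∀ k, stdSimplex ℝ (J k) := fun l k =>
    ⟨fun j => ((l k).1 j + g k j l) / (1 + ∑ j, g k j l),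
      fun j => div_nonneg (add_nonneg ((l k).2.1 j) (hg0 k j l)) (hden k l).le, by
        rw [← Finset.sum_div, Finset.sum_add_distrib, (l k).2.2, div_self (hden k l).ne']⟩
  have hT : Continuous T := by
    refine continuous_pi fun k => Continuous.subtype_mk (continuous_pi fun j => ?_) _
    refine Continuous.div (Continuous.add ?_ (hg k j)) ?_ fun l => (hden k l).ne'
    · exact (continuous_apply j).comp (continuous_subtype_val.comp (continuous_apply k))
    · exact continuous_const.add (continuous_finsetSum _ fun j _ => hg k j)
  obtain ⟨l, hl⟩ := exists_fixedPoint_pi_stdSimplex hT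
  obtain ⟨k, j₀, hkj⟩ := hcover l
  refine ⟨l, k, fun j hj => ?_⟩
  have hfix : ((l k).1 j + g k j l) / (1 + ∑ j, g k j l) = (l k).1 j :=
    congrFun (congrArg Subtype.val (congrFun hl k)) j
  have hgj : g k j l = 0 := le_antisymm (not_lt.mp fun h => hj ((hgpos k j l).mp h)) (hg0 k j l)
  have hpos : 0 < ∑ j, g k j l := Finset.sum_pos' (fun j _ => hg0 k j l)
    ⟨j₀, Finset.mem_univ _, (hgpos k j₀ l).mpr hkj⟩
  rw [div_eq_iff (hden k l).ne', hgj, add_zero, mul_add, mul_one, left_eq_add] at hfix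
  exact (mul_eq_zero.mp hfix).resolve_right hpos.ne'

/-! ### Existence of an equilibrium -/

theorem Finset.exists_injective_fin_forall_mem {Z : Type*} {Y : Finset Z} (hY : Y.Nonempty) :
    ∃ (n : ℕ) (z : Fin (n + 1) → Z), Function.Injective z ∧ ∀ y ∈ Y, ∃ j, z j = y := by
  obtain ⟨n, hn⟩ := Nat.exists_eq_succ_of_ne_zero (Finset.card_pos.mpr hY).ne'
  let e := Y.equivFinOfCardEq hn
  exact ⟨n, fun j => (e.symm j).1, Subtype.val_injective.comp e.symm.injective,
    fun y hy => ⟨e ⟨y, hy⟩, by simp⟩⟩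

theorem theorem2 {I : Type*} {X : I → Type*}
    [∀ i, TopologicalSpace (X i)] [∀ i, T2Space (X i)]
    [∀ i, Nonempty (X i)] [∀ i, CompactSpace (X i)]
    (P : (i : I) → ((j : I) → X j) → Set (X i))
    (hsimplex : ∀ i, QualitativeGame.SimplexMapCondition (P i))
    (hopen : ∀ i, HasOpenLowerSections (P i))
    (hirrefl : ∀ (i : I) (x : (j : I) → X j), x i ∉ P i x) :
    ∃ x : (j : I) → X j, QualitativeGame.IsEquilibrium P x := by
  classical
  by_contra hno
  have hne : ∀ x : (j : I) → X j, ∃ i y, y ∈ P i x := by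
    intro x
    by_contra! h
    exact hno ⟨x, fun i => Set.eq_empty_of_forall_notMem (h i)⟩
  have hopen' : ∀ i y, IsOpen {x | y ∈ P i x} := fun i =>
    hasOpenLowerSections_iff_isOpen.mp (hopen i)
  obtain ⟨t, ht⟩ := isCompact_univ.elim_finite_subcover
    (fun q : Σ i, X i => {x : (j : I) → X j | q.2 ∈ P q.1 x}) (fun q => hopen' q.1 q.2)
    (fun x _ => by
      obtain ⟨i, y, h⟩ := hne x
      exact Set.mem_iUnion.mpr ⟨⟨i, y⟩, h⟩)
  have hcover : ∀ x : (j : I) → X j, ∃ q ∈ t, q.2 ∈ P q.1 x := fun x => by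
    simpa using ht (Set.mem_univ x)
  let x₀ : (j : I) → X j := fun i => Classical.arbitrary _
  -- Inserting `x₀ i` keeps the list nonempty for players absent from `t`.
  choose n z hz hzt using fun i => Finset.exists_injective_fin_forall_mem
    (Finset.insert_nonempty (x₀ i) (t.preimage (Sigma.mk i) sigma_mk_injective.injOn))
  choose φ hφ hφP using fun i => hsimplex i (n i) (z i) (hz i)
  let K := {i // i ∈ t.image Sigma.fst}
  let Φ : (∀ k : K, stdSimplex ℝ (Fin (n k + 1))) → (i : I) → X i := fun l i =>
    if h : i ∈ t.image Sigma.fst then φ i (l ⟨i, h⟩) else x₀ i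
  have hΦ : Continuous Φ := by
    refine continuous_pi fun i => ?_
    by_cases h : i ∈ t.image Sigma.fst
    · simp only [Φ, h, dif_pos]
      exact (hφ i).comp (continuous_apply _)
    · simp only [Φ, h, dif_neg, not_false_eq_true]
      exact continuous_const
  obtain ⟨l, k, hk⟩ := exists_carried_of_isOpen_cover
    (V := fun (k : K) j => Φ ⁻¹' {x | z k j ∈ P k x})
    (fun k j => (hopen' k (z k j)).preimage hΦ) (fun l => by
      obtain ⟨⟨i, y⟩, hq, hy⟩ := hcover (Φ l)
      obtain ⟨j, rfl⟩ := hzt i y (Finset.mem_insert_of_mem (by simpa using hq))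
      exact ⟨⟨i, Finset.mem_image_of_mem Sigma.fst hq⟩, j, hy⟩)
  refine hirrefl k (Φ l) ?_
  have hΦk : Φ l k = φ k (l k) := dif_pos k.2
  rw [hΦk]
  refine hφP k {j | z k j ∈ P k (Φ l)} (Φ l) ?_ (l k) hk
  exact Set.mem_iInter₂.mpr fun j hj => hj
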